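/- Let $L_1, C_1, r_1, E > 0$ and $P \ge 0$ be real numbers, and consider the system $$L_1 \dot i_1 = -r_1 i_1 - v_1 + E, \qquad C_1 \dot v_1 = i_1 - \frac{P}{v_1}$$ on the state space $\{(i_1,v_1)\in\mathbb{R}^2 : v_1 > 0\}$. Put $\Delta = E^2 - 4 P r_1$. Real equilibrium points exist if and only if $\Delta \ge 0$, and in that case $$(\bar i_1, \bar v_1) = \left(\frac{E - \sqrt{\Delta}}{2 r_1},\ \frac{E + \sqrt{\Delta}}{2}\right)$$ denotes the equilibrium point with the highest voltage. Stability and asymptotic stability are meant in the (local) sense of Lyapunov, and "$(\bar i_1, \bar v_1)$ is stable" includes that this equilibrium point is real. (a) Suppose that $C_1 < L_1/r_1^2$. If $(\bar i_1, \bar v_1)$ is stable, then $$P \le \frac{E^2 C_1 L_1 r_1}{(L_1 + C_1 r_1^2)^2},$$ and if this inequality holds strictly, then $(\bar i_1, \bar v_1)$ is asymptotically stable. (b) Suppose that $C_1 \ge L_1/r_1^2$. Then $(\bar i_1, \bar v_1)$ is stable if and only if $$P < \frac{E^2}{4 r_1}.$$ -/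

import Mathlib

namespace CPL

section General

variable {V : Type*} [NormedAddCommGroup V] [NormedSpace ℝ V]

/-- `x` is a solution, defined for all times `t ≥ 0` and staying in the state space `X`, of the
autonomous equation `x' = f x` with initial value `x₀` (the derivative at `t = 0` is one-sided). -/
def IsSolution (f : V → V) (X : Set V) (x₀ : V) (x : ℝ → V) : Prop :=
  x 0 = x₀ ∧ ∀ t : ℝ, 0 ≤ t → x t ∈ X ∧ HasDerivWithinAt x (f (x t)) (Set.Ici 0) t

/-- `xe` is an equilibrium point of `x' = f x` on the state space `X`. -/
def IsEquilibrium (f : V → V) (X : Set V) (xe : V) : Prop :=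
  xe ∈ X ∧ f xe = 0

/-- Lyapunov stability of the equilibrium point `xe`: solutions that start close enough to `xe`
exist for all positive times and remain as close to `xe` as desired. -/
def IsStable (f : V → V) (X : Set V) (xe : V) : Prop :=
  IsEquilibrium f X xe ∧
    ∀ ε : ℝ, 0 < ε → ∃ δ : ℝ, 0 < δ ∧ ∀ x₀ ∈ X, dist x₀ xe < δ →
      (∃ x : ℝ → V, IsSolution f X x₀ x) ∧
      ∀ x : ℝ → V, IsSolution f X x₀ x → ∀ t : ℝ, 0 ≤ t → dist (x t) xe < ε

/-- (Local) asymptotic stability: stability together with attractivity. -/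
def IsAsymptoticallyStable (f : V → V) (X : Set V) (xe : V) : Prop :=
  IsStable f X xe ∧
    ∃ δ : ℝ, 0 < δ ∧ ∀ x₀ ∈ X, dist x₀ xe < δ →
      ∀ x : ℝ → V, IsSolution f X x₀ x → Filter.Tendsto x Filter.atTop (nhds xe)

end General

/-- The state space `{(i₁, v₁) : v₁ > 0}`. -/
def stateSpace : Set (ℝ × ℝ) := {x | 0 < x.2}

/-- The open-loop network in the state `x = (i₁, v₁)`:
`L₁ i₁' = -r₁ i₁ - v₁ + E`, `C₁ v₁' = i₁ - P / v₁`. -/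
noncomputable def network (L₁ C₁ r₁ E P : ℝ) (x : ℝ × ℝ) : ℝ × ℝ :=
  ((-r₁ * x.1 - x.2 + E) / L₁, (x.1 - P / x.2) / C₁)

/-- The discriminant `Δ = E² - 4 P r₁`. -/
def discr (r₁ E P : ℝ) : ℝ := E ^ 2 - 4 * P * r₁

/-- The point `(ī₁, v̄₁) = ((E - √Δ) / (2 r₁), (E + √Δ) / 2)`, i.e. the equilibrium point with the
highest voltage. If `Δ < 0` there is no real equilibrium point; then the value of this
expression is not an equilibrium point, and so it is not stable in the sense of `IsStable`. -/
noncomputable def equilibriumPoint (r₁ E P : ℝ) : ℝ × ℝ :=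
  ((E - √(discr r₁ E P)) / (2 * r₁), (E + √(discr r₁ E P)) / 2)

end CPL

/-! Writing `E = r i₀ + v₀` and `P = i₀ v₀` around the equilibrium `(i₀, v₀)`, the linearization has
determinant a positive multiple of `v₀ - r i₀ = √Δ` and trace a positive multiple of `L i₀ - r C
v₀`. For `Δ > 0` the sign of a nonzero trace decides stability by Lyapunov's indirect method
(`isAsymptoticallyStable_of_trace_neg`, `not_isStable_of_trace_pos`), carried by one quadratic
function whose derivative along `z' = A z` is `2 det A tr A |z|²`. `critical_power_sub` turns the
bound on `P` into the sign of the trace when `C r² < L`; when `C r² ≥ L`, the inequality `r i₀ < v₀`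
alone makes the trace negative. For `Δ = 0` the determinant vanishes and instability needs a
nonlinear argument (`network_not_isStable_of_double`). -/

namespace CPL

open Set Filter Topology
open scoped NNReal

/-! ### Global existence for bounded Lipschitz fields. -/

section GlobalExistence

variable {V : Type*} [NormedAddCommGroup V] [NormedSpace ℝ V]

/-- A bounded, globally Lipschitz vector field on a Banach space has forward solutions for all
times. -/
lemma exists_forward_solution [CompleteSpace V] {g : V → V} {K M : ℝ≥0}
    (hK : LipschitzWith K g) (hM : ∀ x, ‖g x‖ ≤ M) (x₀ : V) :
    ∃ x : ℝ → V, IsSolution g univ x₀ x := by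
  have hloc : ∀ n : ℕ, ∃ α : ℝ → V, α 0 = x₀ ∧ ∀ t ∈ Icc (0 : ℝ) (n + 1),
      HasDerivWithinAt α (g (α t)) (Icc (0 : ℝ) (n + 1)) t := by
    intro n
    have hn : (0 : ℝ) ≤ n + 1 := by positivity
    have hpl : IsPicardLindelof (fun _ => g) (tmin := 0) (tmax := (n : ℝ) + 1)
        ⟨0, left_mem_Icc.2 hn⟩ x₀ (M * (n + 1)) 0 M K :=
      { lipschitzOnWith := fun _ _ => hK.lipschitzOnWith
        continuousOn := fun _ _ => continuousOn_const
        norm_le := fun _ _ x _ => hM x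
        mul_max_le := by simp [hn] }
    exact hpl.exists_eq_forall_mem_Icc_hasDerivWithinAt₀
  choose α hα0 hα using hloc
  have hagree : ∀ m n : ℕ, ∀ s : ℝ, 0 ≤ s → s ≤ m + 1 → s ≤ n + 1 → α m s = α n s := by
    intro m n s hs hsm hsn
    have key : ∀ k : ℕ, s ≤ k + 1 → ContinuousOn (α k) (Icc 0 s) ∧
        ∀ t ∈ Ico 0 s, HasDerivWithinAt (α k) (g (α k t)) (Ici t) t := by
      intro k hk
      refine ⟨fun t ht => ((hα k t ⟨ht.1, ht.2.trans hk⟩).continuousWithinAt).mono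
        (Icc_subset_Icc_right hk), fun t ht => ?_⟩
      have hlt : t < k + 1 := ht.2.trans_le hk
      exact ((hα k t ⟨ht.1, hlt.le⟩).mono (Icc_subset_Icc_left ht.1)).mono_of_mem_nhdsWithin
        (Icc_mem_nhdsGE hlt)
    exact ODE_solution_unique_of_mem_Icc_right (v := fun _ => g) (s := fun _ => univ)
      (fun _ _ => hK.lipschitzOnWith) (key m hsm).1 (key m hsm).2 (fun _ _ => mem_univ _)
      (key n hsn).1 (key n hsn).2 (fun _ _ => mem_univ _) (by rw [hα0, hα0]) ⟨hs, le_rfl⟩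
  -- The local solution of index `⌈t⌉₊` lives up to `⌈t⌉₊ + 1`, so `t` is never a right endpoint.
  refine ⟨fun t => α ⌈t⌉₊ t, hα0 _, fun t ht => ⟨mem_univ _, ?_⟩⟩
  have hceil : ∀ s : ℝ, s ≤ ⌈s⌉₊ + 1 := fun s => (Nat.le_ceil s).trans (by linarith)
  have htlt : t < (⌈t⌉₊ : ℝ) + 1 := (Nat.le_ceil t).trans_lt (by linarith)
  have hmem : Icc (0 : ℝ) (⌈t⌉₊ + 1) ∈ 𝓝[Ici 0] t := by
    rw [← Ici_inter_Iic]
    exact inter_mem self_mem_nhdsWithin (mem_nhdsWithin_of_mem_nhds (Iic_mem_nhds htlt))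
  refine ((hα ⌈t⌉₊ t ⟨ht, htlt.le⟩).mono_of_mem_nhdsWithin hmem).congr_of_eventuallyEq ?_ rfl
  filter_upwards [hmem] with s hs
  exact hagree _ _ s hs.1 (hceil s) hs.2

end GlobalExistence

/-- Exponential fencing: a function that satisfies `v' < k * v` wherever it touches `c * exp (k t)`
stays below that curve. -/
lemma le_mul_exp_of_deriv_lt {v v' : ℝ → ℝ} {c k : ℝ}
    (hv : ∀ t, 0 ≤ t → HasDerivWithinAt v (v' t) (Ici 0) t) (h0 : v 0 ≤ c)
    (hlt : ∀ t, 0 ≤ t → v t = c * Real.exp (k * t) → v' t < k * v t) {t : ℝ} (ht : 0 ≤ t) :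
    v t ≤ c * Real.exp (k * t) := by
  refine image_le_of_deriv_right_lt_deriv_boundary (f := v) (f' := v') (a := 0) (b := t)
    (B := fun s => c * Real.exp (k * s)) (B' := fun s => k * (c * Real.exp (k * s)))
    (fun s hs => (hv s hs.1).continuousWithinAt.mono Icc_subset_Ici_self)
    (fun s hs => (hv s hs.1).mono (Ici_subset_Ici.2 hs.1)) (by simpa using h0)
    (fun s => ?_) (fun s hs h => ?_) ⟨ht, le_rfl⟩
  · have := (((hasDerivAt_id s).const_mul k).exp).const_mul c
    simpa [mul_comm, mul_left_comm, mul_assoc] using this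
  · rw [← h]; exact hlt s hs.1 h

/-! ### A Lyapunov function for planar matrices. -/

/-- The quadratic Lyapunov function of the planar matrix `!![a, b; c, d]`, namely
`|adj A z|² + det A * |z|²`. -/
def quadLyap (a b c d x y : ℝ) : ℝ :=
  (d * x - b * y) ^ 2 + (a * y - c * x) ^ 2 + (a * d - b * c) * (x ^ 2 + y ^ 2)

/-- The derivative of `quadLyap` at `(x, y)` in the direction `(p, q)`. -/
def quadLyapDeriv (a b c d x y p q : ℝ) : ℝ :=
  2 * (d * x - b * y) * (d * p - b * q) + 2 * (a * y - c * x) * (a * q - c * p) +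
    (a * d - b * c) * (2 * x * p + 2 * y * q)

lemma hasDerivWithinAt_quadLyap {a b c d p q t : ℝ} {s : Set ℝ} {x y : ℝ → ℝ}
    (hx : HasDerivWithinAt x p s t) (hy : HasDerivWithinAt y q s t) :
    HasDerivWithinAt (fun τ => quadLyap a b c d (x τ) (y τ))
      (quadLyapDeriv a b c d (x t) (y t) p q) s t := by
  have h := ((((hx.const_mul d).sub (hy.const_mul b)).pow 2).add
    (((hy.const_mul a).sub (hx.const_mul c)).pow 2)).add
    (((hx.pow 2).add (hy.pow 2)).const_mul (a * d - b * c))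
  unfold quadLyap quadLyapDeriv
  refine h.congr_deriv ?_
  simp only [Pi.sub_apply]
  push_cast
  ring

lemma det_mul_le_quadLyap (a b c d x y : ℝ) :
    (a * d - b * c) * (x ^ 2 + y ^ 2) ≤ quadLyap a b c d x y := by
  unfold quadLyap
  nlinarith [sq_nonneg (d * x - b * y), sq_nonneg (a * y - c * x)]

lemma quadLyap_le (a b c d x y : ℝ) :
    quadLyap a b c d x y ≤
      (a ^ 2 + b ^ 2 + c ^ 2 + d ^ 2 + (a * d - b * c)) * (x ^ 2 + y ^ 2) := by
  unfold quadLyap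
  nlinarith [sq_nonneg (d * y + b * x), sq_nonneg (a * x + c * y)]

/-- Along `x' = a x + b y`, `y' = c x + d y + O(y²)` the derivative of `quadLyap` is
`2 det A tr A |z|²` up to a small multiple of `|z|²`. -/
lemma exists_abs_quadLyapDeriv_sub_le (a b c d κ : ℝ) {η : ℝ} (hη : 0 < η) (hκ : 0 ≤ κ) :
    ∃ ρ > 0, ∀ x y p q : ℝ, |x| ≤ ρ → |y| ≤ ρ → p = a * x + b * y →
      |q - (c * x + d * y)| ≤ κ * y ^ 2 →
      |quadLyapDeriv a b c d x y p q - 2 * (a * d - b * c) * (a + d) * (x ^ 2 + y ^ 2)| ≤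
        η * (x ^ 2 + y ^ 2) := by
  obtain ⟨g₁, hg₁⟩ : ∃ g, g = -2 * b * d - 2 * a * c := ⟨_, rfl⟩
  obtain ⟨g₂, hg₂⟩ : ∃ g, g = 2 * b ^ 2 + 2 * a ^ 2 + 2 * (a * d - b * c) := ⟨_, rfl⟩
  have hG : 0 < κ * (|g₁| + |g₂|) + 1 := by positivity
  refine ⟨η / (κ * (|g₁| + |g₂|) + 1), by positivity, ?_⟩
  intro x y p q hx hy hp hq
  set ρ := η / (κ * (|g₁| + |g₂|) + 1) with hρ
  have hρ0 : 0 < ρ := by positivity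
  have hρη : κ * (|g₁| + |g₂|) * ρ ≤ η := by
    have : (κ * (|g₁| + |g₂|) + 1) * ρ = η := by rw [hρ]; field_simp
    linarith
  -- Since `adj A * A = det A` and `A + adj A = tr A`, the linear velocity contributes exactly `2
  -- det A tr A |z|²`. What remains is the partial derivative `g₁ x + g₂ y` in the second variable
  -- times the error.
  have hid : quadLyapDeriv a b c d x y p q - 2 * (a * d - b * c) * (a + d) * (x ^ 2 + y ^ 2) =
      (g₁ * x + g₂ * y) * (q - (c * x + d * y)) := by
    rw [hp, hg₁, hg₂]; unfold quadLyapDeriv; ring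
  have hlin : |g₁ * x + g₂ * y| ≤ (|g₁| + |g₂|) * ρ :=
    calc |g₁ * x + g₂ * y| ≤ |g₁| * |x| + |g₂| * |y| := by
          rw [← abs_mul, ← abs_mul]; exact abs_add_le _ _
      _ ≤ |g₁| * ρ + |g₂| * ρ := by gcongr
      _ = _ := by ring
  rw [hid, abs_mul]
  calc |g₁ * x + g₂ * y| * |q - (c * x + d * y)| ≤ ((|g₁| + |g₂|) * ρ) * (κ * y ^ 2) := by gcongr
    _ = (κ * (|g₁| + |g₂|) * ρ) * y ^ 2 := by ring
    _ ≤ η * y ^ 2 := by gcongr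
    _ ≤ η * (x ^ 2 + y ^ 2) := by gcongr; nlinarith [sq_nonneg x]

lemma hasDerivWithinAt_fst_sub {x : ℝ → ℝ × ℝ} {x' : ℝ × ℝ} {s : Set ℝ} {t : ℝ} (r : ℝ)
    (h : HasDerivWithinAt x x' s t) : HasDerivWithinAt (fun τ => (x τ).1 - r) x'.1 s t :=
  ((ContinuousLinearMap.fst ℝ ℝ ℝ).hasFDerivAt.comp_hasDerivWithinAt t h).sub_const r

lemma hasDerivWithinAt_snd_sub {x : ℝ → ℝ × ℝ} {x' : ℝ × ℝ} {s : Set ℝ} {t : ℝ} (r : ℝ)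
    (h : HasDerivWithinAt x x' s t) : HasDerivWithinAt (fun τ => (x τ).2 - r) x'.2 s t :=
  ((ContinuousLinearMap.snd ℝ ℝ ℝ).hasFDerivAt.comp_hasDerivWithinAt t h).sub_const r

lemma prod_dist_le_iff {x y : ℝ × ℝ} {r : ℝ} :
    dist x y ≤ r ↔ |x.1 - y.1| ≤ r ∧ |x.2 - y.2| ≤ r := by
  rw [Prod.dist_eq, max_le_iff, Real.dist_eq, Real.dist_eq]

lemma prod_dist_le_of_sq_add_sq_le {x y : ℝ × ℝ} {r : ℝ} (hr : 0 ≤ r)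
    (h : (x.1 - y.1) ^ 2 + (x.2 - y.2) ^ 2 ≤ r ^ 2) : dist x y ≤ r :=
  prod_dist_le_iff.2 ⟨abs_le_of_sq_le_sq (by nlinarith [sq_nonneg (x.2 - y.2)]) hr,
    abs_le_of_sq_le_sq (by nlinarith [sq_nonneg (x.1 - y.1)]) hr⟩

lemma sq_add_sq_le_of_prod_dist_le {x y : ℝ × ℝ} {r : ℝ} (h : dist x y ≤ r) :
    (x.1 - y.1) ^ 2 + (x.2 - y.2) ^ 2 ≤ 2 * r ^ 2 := by
  obtain ⟨h1, h2⟩ := prod_dist_le_iff.1 h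
  have := sq_le_sq' (abs_le.1 h1).1 (abs_le.1 h1).2
  have := sq_le_sq' (abs_le.1 h2).1 (abs_le.1 h2).2
  linarith

/-- The velocity `w` at the state `x` of a planar system near the point `e` is given by the matrix
`!![a, b; c, d]` up to a quadratic error in the second component. -/
def IsQuadPerturbation (a b c d κ : ℝ) (e x w : ℝ × ℝ) : Prop :=
  w.1 = a * (x.1 - e.1) + b * (x.2 - e.2) ∧
    |w.2 - (c * (x.1 - e.1) + d * (x.2 - e.2))| ≤ κ * (x.2 - e.2) ^ 2

/-! ### Lyapunov's indirect method in the plane. -/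

section Planar

variable {a b c d κ ρ : ℝ} {e : ℝ × ℝ}

/-- Exponential decay near an equilibrium point whose linearization has positive determinant and
negative trace. -/
lemma exists_exponential_decay (hκ : 0 ≤ κ) (hρ : 0 < ρ) (hD : 0 < a * d - b * c)
    (hT : a + d < 0) {ε : ℝ} (hε : 0 < ε) :
    ∃ δ > 0, ∃ k > 0, ∀ x x' : ℝ → ℝ × ℝ,
      (∀ t, 0 ≤ t → HasDerivWithinAt x (x' t) (Ici 0) t) →
      (∀ t, 0 ≤ t → dist (x t) e ≤ ρ → IsQuadPerturbation a b c d κ e (x t) (x' t)) →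
      dist (x 0) e < δ → ∀ t, 0 ≤ t → dist (x t) e < ε * Real.exp (-k * t) := by
  set D := a * d - b * c with hDdef
  set M := a ^ 2 + b ^ 2 + c ^ 2 + d ^ 2 + D with hM
  have hM0 : 0 < M := by positivity
  have hDT : 0 < D * -(a + d) := mul_pos hD (by linarith)
  obtain ⟨ρ₁, hρ₁, hquad⟩ := exists_abs_quadLyapDeriv_sub_le a b c d κ hDT hκ
  set σ := min (ε / 2) (min ρ ρ₁) with hσ
  have hσ0 : 0 < σ := lt_min (by positivity) (lt_min hρ hρ₁)
  have hσε : σ < ε := (min_le_left _ _).trans_lt (by linarith)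
  have hσρ : σ ≤ ρ := (min_le_right _ _).trans (min_le_left _ _)
  have hσρ₁ : σ ≤ ρ₁ := (min_le_right _ _).trans (min_le_right _ _)
  -- Half of the linear decay absorbs the error; the other half is `2 k M |z|² ≥ 2 k V`, and the
  -- spare factor 2 gives the strict inequality for fencing.
  set k := D * -(a + d) / (2 * M) with hk
  have hk0 : 0 < k := by positivity
  have hkM : 2 * k * M = D * -(a + d) := by rw [hk]; field_simp
  have hδ0 : 0 < D * σ ^ 2 / (2 * M) := by positivity
  refine ⟨√(D * σ ^ 2 / (2 * M)), Real.sqrt_pos.2 hδ0, k / 2, by positivity, ?_⟩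
  intro x x' hx hpert h0
  have hbound : ∀ t, 0 ≤ t → quadLyap a b c d ((x t).1 - e.1) ((x t).2 - e.2) ≤
      D * σ ^ 2 * Real.exp (-k * t) := by
    intro t ht
    refine le_mul_exp_of_deriv_lt
      (v := fun t => quadLyap a b c d ((x t).1 - e.1) ((x t).2 - e.2))
      (fun s hs => hasDerivWithinAt_quadLyap (hasDerivWithinAt_fst_sub e.1 (hx s hs))
        (hasDerivWithinAt_snd_sub e.2 (hx s hs))) ?_ (fun s hs hsv => ?_) ht
    · refine (quadLyap_le a b c d _ _).trans ?_
      have := sq_add_sq_le_of_prod_dist_le h0.le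
      rw [Real.sq_sqrt hδ0.le] at this
      calc _ ≤ M * (2 * (D * σ ^ 2 / (2 * M))) := by gcongr
        _ = D * σ ^ 2 := by field_simp
    -- At a touching point `V ≤ D σ²`, hence `|z| ≤ σ`: the perturbation estimate is needed only
    -- there, so no prior confinement of the curve is required.
    · have hpos : 0 < quadLyap a b c d ((x s).1 - e.1) ((x s).2 - e.2) := by
        rw [hsv]; positivity
      have hle1 : Real.exp (-k * s) ≤ 1 := Real.exp_le_one_iff.2 (by nlinarith)
      have hlow := det_mul_le_quadLyap a b c d ((x s).1 - e.1) ((x s).2 - e.2)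
      have hup := quadLyap_le a b c d ((x s).1 - e.1) ((x s).2 - e.2)
      have hn : ((x s).1 - e.1) ^ 2 + ((x s).2 - e.2) ^ 2 ≤ σ ^ 2 := by
        refine le_of_mul_le_mul_left (hlow.trans ?_) hD
        rw [hsv]
        exact mul_le_of_le_one_right (by positivity) hle1
      have hdist := prod_dist_le_of_sq_add_sq_le hσ0.le hn
      obtain ⟨h1, h2⟩ := prod_dist_le_iff.1 hdist
      obtain ⟨hp, hq⟩ := hpert s hs (hdist.trans hσρ)
      have hd := (abs_le.1 (hquad _ _ _ _ (h1.trans hσρ₁) (h2.trans hσρ₁) hp hq)).2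
      show quadLyapDeriv a b c d ((x s).1 - e.1) ((x s).2 - e.2) (x' s).1 (x' s).2 <
        -k * quadLyap a b c d ((x s).1 - e.1) ((x s).2 - e.2)
      have hup' := mul_le_mul_of_nonneg_left hup (by positivity : 0 ≤ 2 * k)
      rw [← mul_assoc, hkM] at hup'
      have := mul_pos hk0 hpos
      linarith
  intro t ht
  have hexp : Real.exp (-k * t) = Real.exp (-(k / 2) * t) ^ 2 := by
    rw [sq, ← Real.exp_add]; ring_nf
  have hle : dist (x t) e ≤ σ * Real.exp (-(k / 2) * t) := by
    refine prod_dist_le_of_sq_add_sq_le (by positivity) ?_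
    refine le_of_mul_le_mul_left ?_ hD
    calc _ ≤ _ := det_mul_le_quadLyap a b c d _ _
      _ ≤ _ := hbound t ht
      _ = _ := by rw [hexp]; ring
  exact hle.trans_lt (by gcongr)

/-- A Lipschitz map on a closed square extends to a bounded and globally Lipschitz map. -/
lemma exists_bounded_lipschitz_extension {f : ℝ × ℝ → ℝ × ℝ} {K : ℝ≥0} (hρ : 0 ≤ ρ)
    (hf : LipschitzOnWith K f (Metric.closedBall e ρ)) :
    ∃ (g : ℝ × ℝ → ℝ × ℝ) (K' M : ℝ≥0), LipschitzWith K' g ∧ (∀ x, ‖g x‖ ≤ M) ∧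
      ∀ x, dist x e ≤ ρ → g x = f x := by
  have h1 : e.1 - ρ ≤ e.1 + ρ := by linarith
  have h2 : e.2 - ρ ≤ e.2 + ρ := by linarith
  obtain ⟨π, hπdef⟩ : ∃ π : ℝ × ℝ → ℝ × ℝ,
      π = fun x => ((projIcc _ _ h1 x.1 : ℝ), (projIcc _ _ h2 x.2 : ℝ)) := ⟨_, rfl⟩
  have hπ : LipschitzWith 1 π := by
    rw [hπdef]
    have := (LipschitzWith.subtype_val _ |>.comp (LipschitzWith.projIcc h1) |>.comp
      LipschitzWith.prod_fst).prodMk (LipschitzWith.subtype_val _ |>.comp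
      (LipschitzWith.projIcc h2) |>.comp LipschitzWith.prod_snd)
    simpa using this
  have hmem : ∀ x, π x ∈ Metric.closedBall e ρ := by
    intro x
    have h3 := (projIcc _ _ h1 x.1).2
    have h4 := (projIcc _ _ h2 x.2).2
    rw [hπdef, Metric.mem_closedBall, prod_dist_le_iff, abs_le, abs_le]
    exact ⟨⟨by linarith [h3.1], by linarith [h3.2]⟩, ⟨by linarith [h4.1], by linarith [h4.2]⟩⟩
  refine ⟨f ∘ π, K * 1, ‖f e‖₊ + K * ρ.toNNReal, ?_, fun x => ?_, fun x hx => ?_⟩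
  · exact lipschitzOnWith_univ.1 (hf.comp hπ.lipschitzOnWith fun x _ => hmem x)
  · have h := hf.dist_le_mul _ (hmem x) e (Metric.mem_closedBall_self hρ)
    have h' : (K : ℝ) * dist (π x) e ≤ K * ρ := by gcongr; exact hmem x
    have h'' := norm_le_norm_add_norm_sub' (f (π x)) (f e)
    rw [dist_eq_norm] at h
    push_cast
    rw [Real.coe_toNNReal _ hρ]
    simp only [Function.comp_apply]
    linarith
  · obtain ⟨h3, h4⟩ := prod_dist_le_iff.1 hx
    rw [abs_le] at h3 h4
    have : π x = x := by
      rw [hπdef]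
      refine Prod.ext ?_ ?_
      · exact congrArg Subtype.val
          (projIcc_of_mem h1 (x := x.1) ⟨by linarith, by linarith⟩)
      · exact congrArg Subtype.val
          (projIcc_of_mem h2 (x := x.2) ⟨by linarith, by linarith⟩)
    rw [Function.comp_apply, this]

/-- Lyapunov's indirect method in the plane, stable case. -/
theorem isAsymptoticallyStable_of_trace_neg {f : ℝ × ℝ → ℝ × ℝ} {X : Set (ℝ × ℝ)} {K : ℝ≥0}
    (hκ : 0 ≤ κ) (hρ : 0 < ρ) (he : f e = 0) (hX : Metric.closedBall e ρ ⊆ X)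
    (hK : LipschitzOnWith K f (Metric.closedBall e ρ))
    (hf : ∀ x, dist x e ≤ ρ → IsQuadPerturbation a b c d κ e x (f x))
    (hD : 0 < a * d - b * c) (hT : a + d < 0) :
    IsAsymptoticallyStable f X e := by
  have hXe : IsEquilibrium f X e := ⟨hX (Metric.mem_closedBall_self hρ.le), he⟩
  refine ⟨⟨hXe, fun ε hε => ?_⟩, ?_⟩
  · obtain ⟨δ, hδ, k, hk, hdec⟩ :=
      exists_exponential_decay (e := e) hκ hρ hD hT (lt_min hε hρ)
    have hlt : ∀ t, 0 ≤ t → min ε ρ * Real.exp (-k * t) ≤ min ε ρ := fun t ht =>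
      mul_le_of_le_one_right (lt_min hε hρ).le (Real.exp_le_one_iff.2 (by nlinarith))
    refine ⟨δ, hδ, fun x₀ _ hx₀ => ⟨?_, fun x hx t ht => ?_⟩⟩
    -- Existence by truncation: the decay estimate keeps the solution for `g` inside the ball, where
    -- `g = f`.
    · obtain ⟨g, K', M, hgK, hgM, hgf⟩ := exists_bounded_lipschitz_extension hρ.le hK
      obtain ⟨x, hx0, hx⟩ := exists_forward_solution hgK hgM x₀
      have hclose : ∀ t, 0 ≤ t → dist (x t) e ≤ ρ := fun t ht =>
        ((hdec x (fun t => g (x t)) (fun t ht => (hx t ht).2)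
          (fun t _ hd => by simpa only [hgf _ hd] using hf _ hd) (by rwa [hx0]) t ht).le.trans
          (hlt t ht)).trans (min_le_right _ _)
      refine ⟨x, hx0, fun t ht => ⟨hX (hclose t ht), ?_⟩⟩
      rw [← hgf _ (hclose t ht)]
      exact (hx t ht).2
    · exact ((hdec x (fun t => f (x t)) (fun t ht => (hx.2 t ht).2) (fun t _ hd => hf _ hd)
        (by rwa [hx.1]) t ht).trans_le (hlt t ht)).trans_le (min_le_left _ _)
  · obtain ⟨δ, hδ, k, hk, hdec⟩ := exists_exponential_decay (e := e) hκ hρ hD hT one_pos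
    refine ⟨δ, hδ, fun x₀ _ hx₀ x hx => ?_⟩
    rw [tendsto_iff_dist_tendsto_zero]
    have hexp : Tendsto (fun t : ℝ => 1 * Real.exp (-k * t)) atTop (𝓝 0) := by
      simp only [one_mul]
      exact Real.tendsto_exp_atBot.comp (tendsto_id.const_mul_atTop_of_neg (by linarith))
    refine squeeze_zero' (Eventually.of_forall fun _ => dist_nonneg) ?_ hexp
    filter_upwards [eventually_ge_atTop 0] with t ht
    exact (hdec x (fun t => f (x t)) (fun t ht => (hx.2 t ht).2) (fun t _ hd => hf _ hd)
      (by rwa [hx.1]) t ht).le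

lemma dist_add_fst_lt {δ s : ℝ} (hs : |s| < δ) : dist (e.1 + s, e.2) e < δ := by
  rw [Prod.dist_eq, max_lt_iff]
  simpa [Real.dist_eq] using And.intro hs ((abs_nonneg s).trans_lt hs)

/-- Lyapunov's indirect method in the plane, totally unstable case. -/
theorem not_isStable_of_trace_pos {f : ℝ × ℝ → ℝ × ℝ} {X : Set (ℝ × ℝ)}
    (hκ : 0 ≤ κ) (hρ : 0 < ρ) (hX : Metric.closedBall e ρ ⊆ X)
    (hf : ∀ x, dist x e ≤ ρ → IsQuadPerturbation a b c d κ e x (f x))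
    (hD : 0 < a * d - b * c) (hT : 0 < a + d) : ¬ IsStable f X e := by
  rintro ⟨-, hst⟩
  set D := a * d - b * c with hDdef
  set M := a ^ 2 + b ^ 2 + c ^ 2 + d ^ 2 + D with hM
  have hM0 : 0 < M := by positivity
  have hDT : 0 < D * (a + d) := mul_pos hD hT
  obtain ⟨ρ₁, hρ₁, hquad⟩ := exists_abs_quadLyapDeriv_sub_le a b c d κ hDT hκ
  set k := D * (a + d) / (2 * M) with hk
  have hk0 : 0 < k := by positivity
  have hkM : 2 * k * M = D * (a + d) := by rw [hk]; field_simp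
  set σ := min ρ ρ₁ with hσ
  have hσ0 : 0 < σ := lt_min hρ hρ₁
  obtain ⟨δ, hδ, hδst⟩ := hst σ hσ0
  obtain ⟨s, hs0, hs⟩ : ∃ s, 0 < s ∧ s < min δ ρ := exists_between (lt_min hδ hρ)
  have habs : |s| < min δ ρ := by rwa [abs_of_pos hs0]
  obtain ⟨⟨x, hx⟩, hall⟩ := hδst (e.1 + s, e.2)
    (hX (dist_add_fst_lt (habs.trans_le (min_le_right _ _))).le)
    (dist_add_fst_lt (habs.trans_le (min_le_left _ _)))
  have hclose := hall x hx
  set v₀ := quadLyap a b c d ((x 0).1 - e.1) ((x 0).2 - e.2) with hv₀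
  have hv₀pos : 0 < v₀ := by
    refine lt_of_lt_of_le ?_ (det_mul_le_quadLyap a b c d _ _)
    rw [hx.1]
    have : e.1 + s - e.1 = s := by ring
    simp only [this, sub_self]
    positivity
  -- Stability confines the solution, so the estimates hold at all times; fencing `-V` makes `V`
  -- grow exponentially, although it is bounded on the ball.
  have hgrow : ∀ t, 0 ≤ t → -quadLyap a b c d ((x t).1 - e.1) ((x t).2 - e.2) ≤
      -v₀ * Real.exp (k * t) := by
    intro t ht
    refine le_mul_exp_of_deriv_lt
      (v := fun t => -quadLyap a b c d ((x t).1 - e.1) ((x t).2 - e.2))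
      (fun s hs => (hasDerivWithinAt_quadLyap (hasDerivWithinAt_fst_sub e.1 (hx.2 s hs).2)
        (hasDerivWithinAt_snd_sub e.2 (hx.2 s hs).2)).neg) le_rfl (fun s hs hsv => ?_) ht
    have hpos : 0 < quadLyap a b c d ((x s).1 - e.1) ((x s).2 - e.2) := by
      have := mul_pos hv₀pos (Real.exp_pos (k * s))
      linarith
    have hup := quadLyap_le a b c d ((x s).1 - e.1) ((x s).2 - e.2)
    obtain ⟨h1, h2⟩ := prod_dist_le_iff.1 ((hclose s hs).le.trans (min_le_right _ _))
    obtain ⟨hp, hq⟩ := hf _ ((hclose s hs).le.trans (min_le_left _ _))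
    have hd := (abs_le.1 (hquad _ _ _ _ h1 h2 hp hq)).1
    show -quadLyapDeriv a b c d ((x s).1 - e.1) ((x s).2 - e.2) (f (x s)).1 (f (x s)).2 <
      k * -quadLyap a b c d ((x s).1 - e.1) ((x s).2 - e.2)
    have hup' := mul_le_mul_of_nonneg_left hup (by positivity : 0 ≤ 2 * k)
    rw [← mul_assoc, hkM] at hup'
    have := mul_pos hk0 hpos
    linarith
  have hbdd : ∀ t, 0 ≤ t → v₀ * Real.exp (k * t) ≤ M * (2 * σ ^ 2) := fun t ht =>
    calc v₀ * Real.exp (k * t) ≤ quadLyap a b c d ((x t).1 - e.1) ((x t).2 - e.2) := by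
          linarith [hgrow t ht]
      _ ≤ _ := quadLyap_le a b c d _ _
      _ ≤ M * (2 * σ ^ 2) := by
          gcongr; exact sq_add_sq_le_of_prod_dist_le (hclose t ht).le
  have hlim : Tendsto (fun t : ℝ => v₀ * Real.exp (k * t)) atTop atTop :=
    (Real.tendsto_exp_atTop.comp (tendsto_id.const_mul_atTop hk0)).const_mul_atTop hv₀pos
  obtain ⟨t, ht, ht0⟩ := ((hlim.eventually_gt_atTop _).and (eventually_ge_atTop 0)).exists
  exact absurd (hbdd t ht0) (not_le.2 ht)

end Planar

lemma le_add_mul_of_deriv_le {v v' : ℝ → ℝ} {m : ℝ}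
    (hv : ∀ t, 0 ≤ t → HasDerivWithinAt v (v' t) (Ici 0) t) (hm : ∀ t, 0 ≤ t → v' t ≤ m)
    {t : ℝ} (ht : 0 ≤ t) : v t ≤ v 0 + m * t := by
  have hB : ∀ s : ℝ, HasDerivAt (fun s => v 0 + m * s) m s := fun s => by
    simpa using ((hasDerivAt_id s).const_mul m).const_add (v 0)
  exact image_le_of_deriv_right_le_deriv_boundary (f := v) (f' := v') (a := 0) (b := t)
    (B := fun s => v 0 + m * s) (B' := fun _ => m)
    (fun s hs => (hv s hs.1).continuousWithinAt.mono Icc_subset_Ici_self)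
    (fun s hs => (hv s hs.1).mono (Ici_subset_Ici.2 hs.1)) (by simp)
    (fun s _ => (hB s).continuousAt.continuousWithinAt) (fun s _ => (hB s).hasDerivWithinAt)
    (fun s hs => hm s hs.1) ⟨ht, le_rfl⟩

/-! ### The network near its equilibrium. -/

section Network

variable {L C r i₀ v₀ : ℝ}

lemma closedBall_subset_stateSpace (hv : 0 < v₀) {ρ : ℝ} (hρ : ρ ≤ v₀ / 2) :
    Metric.closedBall (i₀, v₀) ρ ⊆ stateSpace := by
  intro x hx
  have h2 := (abs_le.1 (prod_dist_le_iff.1 (Metric.mem_closedBall.1 hx)).2).1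
  show 0 < x.2
  simp only at h2
  linarith

/-- The network written around its equilibrium point `(i₀, v₀)`. -/
lemma network_snd_eq (hv : v₀ ≠ 0) (hC : C ≠ 0) (E : ℝ) {x : ℝ × ℝ} (hx : x.2 ≠ 0) :
    (network L C r E (i₀ * v₀) x).2 =
      1 / C * (x.1 - i₀) + i₀ / (v₀ * C) * (x.2 - v₀) - i₀ / (v₀ * C) * ((x.2 - v₀) ^ 2 / x.2) := by
  simp only [network]
  field_simp
  ring

/-- The constant comes from `1 / v ≤ 2 / v₀` on the ball of radius `v₀ / 2`, applied to the exact
remainder in `network_snd_eq`. -/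
lemma isQuadPerturbation_network (hL : 0 < L) (hC : 0 < C) (hv : 0 < v₀) (hi : 0 ≤ i₀)
    {x : ℝ × ℝ} (hx : dist x (i₀, v₀) ≤ v₀ / 2) :
    IsQuadPerturbation (-(r / L)) (-(1 / L)) (1 / C) (i₀ / (v₀ * C)) (i₀ / (v₀ * C) * (2 / v₀))
      (i₀, v₀) x (network L C r (r * i₀ + v₀) (i₀ * v₀) x) := by
  have h2 := (abs_le.1 (prod_dist_le_iff.1 hx).2).1
  simp only at h2
  have hx2 : v₀ / 2 ≤ x.2 := by linarith
  have hx0 : 0 < x.2 := by linarith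
  constructor
  · simp only [network]
    field_simp
    ring
  · rw [network_snd_eq hv.ne' hC.ne' _ hx0.ne']
    have hq : (x.2 - v₀) ^ 2 / x.2 ≤ 2 / v₀ * (x.2 - v₀) ^ 2 := by
      rw [div_le_iff₀ hx0]
      have h1 : 1 ≤ 2 / v₀ * x.2 := by
        rw [div_mul_eq_mul_div, le_div_iff₀ hv]; linarith
      nlinarith [mul_le_mul_of_nonneg_right h1 (sq_nonneg (x.2 - v₀))]
    have hnn : 0 ≤ i₀ / (v₀ * C) := by positivity
    rw [show ∀ A B G : ℝ, A + B - G - (A + B) = -G by intros; ring, abs_neg,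
      abs_of_nonneg (by positivity), mul_assoc]
    gcongr

lemma network_det_eq (hL : L ≠ 0) (hC : C ≠ 0) (hv : v₀ ≠ 0) :
    -(r / L) * (i₀ / (v₀ * C)) - -(1 / L) * (1 / C) = (v₀ - r * i₀) / (L * C * v₀) := by
  field_simp
  ring

lemma network_trace_eq (hL : L ≠ 0) (hC : C ≠ 0) (hv : v₀ ≠ 0) :
    -(r / L) + i₀ / (v₀ * C) = (L * i₀ - r * C * v₀) / (L * C * v₀) := by
  field_simp
  ring

lemma network_equilibrium (hv : v₀ ≠ 0) :
    network L C r (r * i₀ + v₀) (i₀ * v₀) (i₀, v₀) = 0 := by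
  have h : i₀ - i₀ * v₀ / v₀ = 0 := by field_simp; ring
  simp only [network, h]
  ext <;> simp

theorem network_isAsymptoticallyStable (hL : 0 < L) (hC : 0 < C) (hv : 0 < v₀) (hi : 0 ≤ i₀)
    (hdet : r * i₀ < v₀) (htr : L * i₀ < r * C * v₀) :
    IsAsymptoticallyStable (network L C r (r * i₀ + v₀) (i₀ * v₀)) stateSpace (i₀, v₀) := by
  have hsmooth : ContDiffAt ℝ 1 (network L C r (r * i₀ + v₀) (i₀ * v₀)) (i₀, v₀) := by
    have hinv : ContDiffAt ℝ 1 (fun x : ℝ × ℝ => i₀ * v₀ / x.2) (i₀, v₀) :=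
      contDiffAt_const.div contDiffAt_snd hv.ne'
    unfold network
    exact ((((contDiffAt_const.mul contDiffAt_fst).sub contDiffAt_snd).add
      contDiffAt_const).div_const L).prodMk ((contDiffAt_fst.sub hinv).div_const C)
  obtain ⟨K, s, hs, hK⟩ := hsmooth.exists_lipschitzOnWith
  obtain ⟨ρ, hρ, hρs⟩ := Metric.nhds_basis_closedBall.mem_iff.1 hs
  refine isAsymptoticallyStable_of_trace_neg (ρ := min ρ (v₀ / 2)) (K := K) (by positivity)
    (lt_min hρ (by positivity)) (network_equilibrium hv.ne')
    (closedBall_subset_stateSpace hv (min_le_right _ _))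
    (hK.mono ((Metric.closedBall_subset_closedBall (min_le_left _ _)).trans hρs))
    (fun x hx => isQuadPerturbation_network hL hC hv hi (hx.trans (min_le_right _ _))) ?_ ?_
  · rw [network_det_eq hL.ne' hC.ne' hv.ne']
    exact div_pos (by linarith) (by positivity)
  · rw [network_trace_eq hL.ne' hC.ne' hv.ne']
    exact div_neg_of_neg_of_pos (by linarith) (by positivity)

theorem network_not_isStable_of_trace_pos (hL : 0 < L) (hC : 0 < C) (hv : 0 < v₀) (hi : 0 ≤ i₀)
    (hdet : r * i₀ < v₀) (htr : r * C * v₀ < L * i₀) :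
    ¬ IsStable (network L C r (r * i₀ + v₀) (i₀ * v₀)) stateSpace (i₀, v₀) := by
  refine not_isStable_of_trace_pos (ρ := v₀ / 2) (by positivity) (by positivity)
    (closedBall_subset_stateSpace hv le_rfl)
    (fun x hx => isQuadPerturbation_network hL hC hv hi hx) ?_ ?_
  · rw [network_det_eq hL.ne' hC.ne' hv.ne']
    exact div_pos (by linarith) (by positivity)
  · rw [network_trace_eq hL.ne' hC.ne' hv.ne']
    exact div_pos (by linarith) (by positivity)

/-- The saddle-node equilibrium point, at which the two equilibrium points of the network merge, is
not stable: along solutions `L (i - i₀) + r C (v - v₀)` decreases at the rate `(v - v₀)² / v`. -/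
theorem network_not_isStable_of_double (hL : 0 < L) (hC : 0 < C) (hr : 0 < r) (hv : 0 < v₀)
    (hdet : r * i₀ = v₀) :
    ¬ IsStable (network L C r (r * i₀ + v₀) (i₀ * v₀)) stateSpace (i₀, v₀) := by
  rintro ⟨-, hst⟩
  obtain ⟨δ, hδ, hδst⟩ := hst (v₀ / 2) (by positivity)
  obtain ⟨s, hs0, hs⟩ : ∃ s, 0 < s ∧ s < min δ (v₀ / 2) :=
    exists_between (lt_min hδ (by positivity))
  have habs : |-s| < min δ (v₀ / 2) := by rwa [abs_neg, abs_of_pos hs0]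
  obtain ⟨⟨x, hx0, hx⟩, hall⟩ := hδst (i₀ + -s, v₀)
    (closedBall_subset_stateSpace hv le_rfl
      (dist_add_fst_lt (e := (i₀, v₀)) (habs.trans_le (min_le_right _ _))).le)
    (dist_add_fst_lt (e := (i₀, v₀)) (habs.trans_le (min_le_left _ _)))
  have hclose : ∀ t, 0 ≤ t → |(x t).1 - i₀| ≤ v₀ / 2 ∧ |(x t).2 - v₀| ≤ v₀ / 2 := fun t ht =>
    prod_dist_le_iff.1 (hall x ⟨hx0, hx⟩ t ht).le
  have hpos : ∀ t, 0 ≤ t → 0 < (x t).2 := fun t ht => (hx t ht).1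
  have hlow : ∀ t, 0 ≤ t → ((x t).2 - v₀) ^ 2 / (2 * v₀) ≤ ((x t).2 - v₀) ^ 2 / (x t).2 := by
    intro t ht
    have := hpos t ht
    have := (abs_le.1 (hclose t ht).2).2
    gcongr
    linarith
  have hdx : ∀ t, 0 ≤ t → HasDerivWithinAt (fun τ => (x τ).1 - i₀)
      (-(r * ((x t).1 - i₀) + ((x t).2 - v₀)) / L) (Ici 0) t := fun t ht =>
    (hasDerivWithinAt_fst_sub i₀ (hx t ht).2).congr_deriv (by simp only [network]; ring)
  have hdy : ∀ t, 0 ≤ t → HasDerivWithinAt (fun τ => (x τ).2 - v₀)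
      ((r * ((x t).1 - i₀) + ((x t).2 - v₀) - ((x t).2 - v₀) ^ 2 / (x t).2) / (r * C))
      (Ici 0) t := fun t ht => by
    refine (hasDerivWithinAt_snd_sub v₀ (hx t ht).2).congr_deriv ?_
    rw [network_snd_eq hv.ne' hC.ne' _ (hpos t ht).ne', ← hdet]
    have hi : i₀ ≠ 0 := by rintro rfl; simp at hdet; exact hv.ne hdet
    have := (hpos t ht).ne'
    field_simp
  have hdz : ∀ t, 0 ≤ t → HasDerivWithinAt
      (fun τ => L * ((x τ).1 - i₀) + r * C * ((x τ).2 - v₀))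
      (-(((x t).2 - v₀) ^ 2 / (x t).2)) (Ici 0) t := fun t ht =>
    (((hdx t ht).const_mul L).add ((hdy t ht).const_mul (r * C))).congr_deriv (by
      rw [mul_div_cancel₀ _ hL.ne', mul_div_cancel₀ _ (mul_pos hr hC).ne']; ring)
  -- Lowering the initial current by `s` makes this monotone quantity start at `-L s`.
  have hz : ∀ t, 0 ≤ t → L * ((x t).1 - i₀) + r * C * ((x t).2 - v₀) ≤ -(L * s) := by
    intro t ht
    have := le_add_mul_of_deriv_le (m := 0) hdz (fun t ht => neg_nonpos.2
      (div_nonneg (sq_nonneg _) (hpos t ht).le)) ht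
    simp only [hx0] at this
    linarith
  obtain ⟨β, hβ⟩ : ∃ β, β = 1 - r ^ 2 * C / L := ⟨_, rfl⟩
  -- With `p = i - i₀`, `q = v - v₀`, `z = L p + r C q`, the bound on `z` gives `r p + q ≤ β q - r
  -- s`. This `m` completes the square in `h4`, so `W = m z - p` decreases at rate at least `r s /
  -- (2 L)`, yet is bounded below on the ball.
  obtain ⟨m, hm⟩ : ∃ m, m = v₀ * β ^ 2 / (L * (r * s)) := ⟨_, rfl⟩
  have hm0 : 0 ≤ m := by rw [hm]; positivity
  have hdW : ∀ t, 0 ≤ t → HasDerivWithinAt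
      (fun τ => m * (L * ((x τ).1 - i₀) + r * C * ((x τ).2 - v₀)) - ((x τ).1 - i₀))
      (m * -(((x t).2 - v₀) ^ 2 / (x t).2) - -(r * ((x t).1 - i₀) + ((x t).2 - v₀)) / L)
      (Ici 0) t := fun t ht => ((hdz t ht).const_mul m).sub (hdx t ht)
  have hW : ∀ t, 0 ≤ t →
      m * -(((x t).2 - v₀) ^ 2 / (x t).2) - -(r * ((x t).1 - i₀) + ((x t).2 - v₀)) / L ≤
        -(r * s / (2 * L)) := by
    intro t ht
    have h1 := mul_le_mul_of_nonneg_left (hlow t ht) hm0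
    have h2 := hz t ht
    generalize (x t).1 - i₀ = p at *
    generalize (x t).2 - v₀ = q at *
    have h3 : (r * p + q) / L ≤ (β * q - r * s) / L := by
      gcongr
      have : r * p + q - (β * q - r * s) = r / L * (L * p + r * C * q + L * s) := by
        rw [hβ]; field_simp; ring
      have : r / L * (L * p + r * C * q + L * s) ≤ 0 :=
        mul_nonpos_of_nonneg_of_nonpos (by positivity) (by linarith)
      linarith
    have h4 : (β * q - r * s) / L + r * s / (2 * L) - m * (q ^ 2 / (2 * v₀)) =
        -((β * q - r * s) ^ 2 / (2 * L * (r * s))) := by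
      rw [hm]; field_simp; ring
    have h5 : 0 ≤ (β * q - r * s) ^ 2 / (2 * L * (r * s)) := by positivity
    rw [neg_div]
    linarith
  have hbelow : ∀ t, 0 ≤ t → -((m * L + m * (r * C) + 1) * (v₀ / 2)) ≤
      m * (L * ((x t).1 - i₀) + r * C * ((x t).2 - v₀)) - ((x t).1 - i₀) := by
    intro t ht
    obtain ⟨h1, h2⟩ := hclose t ht
    rw [abs_le] at h1 h2
    have h3 := mul_le_mul_of_nonneg_left h1.1 (by positivity : 0 ≤ m * L)
    have h4 := mul_le_mul_of_nonneg_left h2.1 (by positivity : 0 ≤ m * (r * C))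
    linarith [h1.2]
  set B := (m * L + m * (r * C) + 1) * (v₀ / 2) with hB
  set W₀ := m * (L * ((x 0).1 - i₀) + r * C * ((x 0).2 - v₀)) - ((x 0).1 - i₀) with hW₀
  have hW₀B : -B ≤ W₀ := hbelow 0 le_rfl
  have hrate : 0 < r * s / (2 * L) := by positivity
  have ht0 : 0 ≤ (W₀ + B + 1) / (r * s / (2 * L)) := div_nonneg (by linarith) hrate.le
  have h1 := le_add_mul_of_deriv_le hdW hW ht0
  have h2 := hbelow _ ht0
  rw [neg_mul, mul_div_cancel₀ _ hrate.ne'] at h1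
  linarith

end Network

/-! ### Critical power and existence of the equilibrium. -/

/-- At the critical power of the network, the difference between the two sides factors; the first
factor is a negative multiple of the trace of the linearization. -/
lemma critical_power_sub (L C r i₀ v₀ : ℝ) :
    (r * i₀ + v₀) ^ 2 * C * L * r - i₀ * v₀ * (L + C * r ^ 2) ^ 2 =
      (r * C * v₀ - L * i₀) * (L * v₀ - r ^ 2 * C * (r * i₀)) := by
  ring

/-- Coordinates of the equilibrium point with the highest voltage. -/
lemma equilibriumPoint_spec {r E P : ℝ} (hr : 0 < r) (hE : 0 < E) (hP : 0 ≤ P)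
    (hΔ : 0 ≤ discr r E P) :
    ∃ i₀ v₀ : ℝ, equilibriumPoint r E P = (i₀, v₀) ∧ 0 < v₀ ∧ 0 ≤ i₀ ∧ E = r * i₀ + v₀ ∧
      P = i₀ * v₀ ∧ v₀ - r * i₀ = √(discr r E P) := by
  have hsq := Real.sq_sqrt hΔ
  have hs0 := Real.sqrt_nonneg (discr r E P)
  have hle : √(discr r E P) ≤ E := by
    refine Real.sqrt_le_iff.2 ⟨hE.le, ?_⟩
    unfold discr
    nlinarith [mul_nonneg hP hr.le]
  refine ⟨(E - √(discr r E P)) / (2 * r), (E + √(discr r E P)) / 2, rfl, by positivity,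
    div_nonneg (by linarith) (by positivity), by field_simp; ring, ?_, by field_simp; ring⟩
  have : (E - √(discr r E P)) * (E + √(discr r E P)) = 4 * P * r := by
    rw [← sub_eq_zero]; ring_nf; rw [hsq]; unfold discr; ring
  field_simp
  linarith

lemma discr_nonneg_of_isEquilibrium {L C r E P : ℝ} (hC : 0 < C) (hr : 0 < r) (hE : 0 < E)
    (h : IsEquilibrium (network L C r E P) stateSpace (equilibriumPoint r E P)) :
    0 ≤ discr r E P := by
  by_contra hneg
  -- For negative `Δ` the root defaults to `0`; the second equation then forces `E² = 4 P r`, that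
  -- is `Δ = 0`.
  have hs : √(discr r E P) = 0 := Real.sqrt_eq_zero_of_nonpos (not_le.1 hneg).le
  have h2 := congrArg Prod.snd h.2
  simp only [network, equilibriumPoint, hs, Prod.snd_zero, div_eq_zero_iff, hC.ne', or_false,
    sub_zero, add_zero] at h2
  apply hneg
  have : E ^ 2 = 4 * P * r := by
    field_simp at h2
    linarith
  unfold discr
  linarith

lemma discr_pos_iff {r E P : ℝ} (hr : 0 < r) : 0 < discr r E P ↔ P < E ^ 2 / (4 * r) := by
  rw [lt_div_iff₀ (by positivity), discr, sub_pos, mul_comm P (4 * r), mul_right_comm,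
    mul_right_comm 4 r P]

end CPL

theorem mainTheorem8 (L₁ C₁ r₁ E P : ℝ)
    (hL : 0 < L₁) (hC : 0 < C₁) (hr : 0 < r₁) (hE : 0 < E) (hP : 0 ≤ P) :
    (C₁ < L₁ / r₁ ^ 2 →
      (CPL.IsStable (CPL.network L₁ C₁ r₁ E P) CPL.stateSpace (CPL.equilibriumPoint r₁ E P) →
        P ≤ E ^ 2 * C₁ * L₁ * r₁ / (L₁ + C₁ * r₁ ^ 2) ^ 2) ∧
      (P < E ^ 2 * C₁ * L₁ * r₁ / (L₁ + C₁ * r₁ ^ 2) ^ 2 →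
        CPL.IsAsymptoticallyStable (CPL.network L₁ C₁ r₁ E P) CPL.stateSpace
          (CPL.equilibriumPoint r₁ E P))) ∧
    (L₁ / r₁ ^ 2 ≤ C₁ →
      (CPL.IsStable (CPL.network L₁ C₁ r₁ E P) CPL.stateSpace (CPL.equilibriumPoint r₁ E P) ↔
        P < E ^ 2 / (4 * r₁))) := by
  have hS : 0 < (L₁ + C₁ * r₁ ^ 2) ^ 2 := by positivity
  refine ⟨fun hk => ⟨fun hst => ?_, fun hlt => ?_⟩, fun hk => ⟨fun hst => ?_, fun hlt => ?_⟩⟩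
  · rw [lt_div_iff₀ (by positivity)] at hk
    have hΔ := CPL.discr_nonneg_of_isEquilibrium hC hr hE hst.1
    obtain ⟨i₀, v₀, he, hv, hi, rfl, rfl, hs⟩ := CPL.equilibriumPoint_spec hr hE hP hΔ
    have hs0 := Real.sqrt_nonneg (CPL.discr r₁ (r₁ * i₀ + v₀) (i₀ * v₀))
    rw [he] at hst
    rcases (show r₁ * i₀ ≤ v₀ by linarith).eq_or_lt with hdet | hdet
    · exact absurd hst (CPL.network_not_isStable_of_double hL hC hr hv hdet)
    · have htr : L₁ * i₀ ≤ r₁ * C₁ * v₀ := not_lt.1 fun h =>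
        CPL.network_not_isStable_of_trace_pos hL hC hv hi hdet h hst
      rw [le_div_iff₀ hS, ← sub_nonneg, CPL.critical_power_sub]
      refine mul_nonneg (by linarith) (sub_nonneg.2 ?_)
      exact mul_le_mul (by linarith) hdet.le (by positivity) hL.le
  · rw [lt_div_iff₀ (by positivity)] at hk
    have hΔ : 0 < CPL.discr r₁ E P := by
      refine (CPL.discr_pos_iff hr).2 (hlt.trans_le ?_)
      rw [div_le_div_iff₀ hS (by positivity)]
      -- The critical power is at most `E² / (4 r)` because `(L + C r²)² - 4 L C r² = (L - C r²)²`.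
      nlinarith [mul_nonneg (sq_nonneg E) (sq_nonneg (L₁ - C₁ * r₁ ^ 2))]
    obtain ⟨i₀, v₀, he, hv, hi, rfl, rfl, hs⟩ := CPL.equilibriumPoint_spec hr hE hP hΔ.le
    have hs0 := Real.sqrt_pos.2 hΔ
    have hdet : r₁ * i₀ < v₀ := by linarith
    rw [he]
    rw [lt_div_iff₀ hS, ← sub_pos, CPL.critical_power_sub] at hlt
    -- Here `C r² < L` and `r i₀ < v₀` combine, leaving the trace factor to carry the sign.
    have hfac : 0 ≤ L₁ * v₀ - r₁ ^ 2 * C₁ * (r₁ * i₀) :=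
      sub_nonneg.2 (mul_le_mul (by linarith) hdet.le (by positivity) hL.le)
    have htr := not_le.1 fun h => hlt.not_ge (mul_nonpos_of_nonpos_of_nonneg h hfac)
    exact CPL.network_isAsymptoticallyStable hL hC hv hi hdet (by linarith)
  · have hΔ := CPL.discr_nonneg_of_isEquilibrium hC hr hE hst.1
    refine (CPL.discr_pos_iff hr).1 (hΔ.lt_of_ne' fun h0 => ?_)
    obtain ⟨i₀, v₀, he, hv, hi, rfl, rfl, hs⟩ := CPL.equilibriumPoint_spec hr hE hP hΔ
    rw [h0, Real.sqrt_zero] at hs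
    rw [he] at hst
    exact CPL.network_not_isStable_of_double hL hC hr hv (by linarith) hst
  · rw [div_le_iff₀ (by positivity)] at hk
    have hΔ := (CPL.discr_pos_iff hr).2 hlt
    obtain ⟨i₀, v₀, he, hv, hi, rfl, rfl, hs⟩ := CPL.equilibriumPoint_spec hr hE hP hΔ.le
    have hs0 := Real.sqrt_pos.2 hΔ
    have hdet : r₁ * i₀ < v₀ := by linarith
    rw [he]
    refine (CPL.network_isAsymptoticallyStable hL hC hv hi hdet ?_).1
    calc L₁ * i₀ ≤ C₁ * r₁ ^ 2 * i₀ := by gcongr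
      _ = r₁ * C₁ * (r₁ * i₀) := by ring
      _ < r₁ * C₁ * v₀ := by gcongr
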